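/- **Setting.** Consider a single-server queue with $K$ customer classes under discriminatory processor sharing, in a random environment. The environment $Z$ is an irreducible continuous-time Markov chain on $\{1,\dots,D\}$ with generator $Q=(q_{d\ell})$ and invariant distribution $\pi=(\pi_1,\dots,\pi_D)$. While $Z=d$, customers arrive in a Poisson stream of rate $\lambda_d\ge 0$, an arriving customer is of class $k$ with probability $\alpha_{k,d}$ (where $\sum_k\alpha_{k,d}=1$), and the service capacity is $c_d\ge 0$, with $c_d>0$ for at least one $d$. Put $\lambda_{k,d}=\alpha_{k,d}\lambda_d$; for each $k$ some $\lambda_{k,d}$ is positive. Class-$k$ customers have exponential service requirements with mean $1/\mu_k$ and weight $g_k>0$: when the queue-length vector is $m=(m_1,\dots,m_K)\neq 0$ and $Z=d$, class-$k$ customers depart at rate $\frac{g_k m_k}{\sum_j g_j m_j}\,\mu_k c_d$. Let $$\rho_\infty=\sum_{k}\frac{\sum_d \pi_d\lambda_{k,d}}{\mu_k\sum_d \pi_d c_d}.$$ For real $N>1$, the $N$-th system has the arrival rates $\lambda^{(N)}_d=\frac{\lambda_d}{\rho_\infty}\left(1-\frac1N\right)$ in place of $\lambda_d$ (so its traffic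 intensity is $1-1/N$), all other parameters being unchanged. Let $(M^{(N)},Z)$ have the stationary distribution of the Markov chain of queue lengths and environment in the $N$-th system, and for $z\in[0,1]^K$ let $$P^{(N)}_d(z)=\mathbb E\Big[\prod_k z_k^{M^{(N)}_k}\,\mathbf 1_{\{Z=d\}}\Big].$$ Write $e^{-s/N}=(e^{-s_1/N},\dots,e^{-s_K/N})$. Below, $N\to\infty$ through all reals or, more generally, along any fixed sequence or filter tending to infinity. **Proposition.** 1. Let $s\in[0,\infty)^K$ be such that the limit $\hat P_d(s)=\lim_{N\to\infty}P^{(N)}_d(e^{-s/N})$ exists for every $d$, and put $\hat P(s)=\sum_d\hat P_d(s)$. Then $\hat P_d(s)=\pi_d\,\hat P(s)$ for every $d$. 2. Consequently the scaled queue-length vector is independent of the environment in heavy traffic: if the limit $\hat P_d(s)$ exists for every $d$ and every $s\in(0,\infty)^K$, and if $\hat M$ (with values in $[0,\infty)^K$ almost surely) and $\hat Z$ (with values in $\{1,\dots,D\}$) are random variables on a probability space with $\hat P_d(s)=\mathbb E\big[e^{-\sum_k s_k\hat M_k}\mathbf 1_{\{\hat Z=d\}}\big]$ for all such $d$ and $s$,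 then $\hat M$ and $\hat Z$ are independent and $\mathbb P(\hat Z=d)=\pi_d$ for every $d$. -/

import Mathlib

open Filter Topology MeasureTheory ProbabilityTheory

/-- The data of a single-server queue with `K` customer classes under discriminatory processor
sharing (DPS), in a random environment with `D` states. -/
structure ModulatedDPS (K D : ℕ) where
  /-- Generator matrix of the environment. -/
  Q : Matrix (Fin D) (Fin D) ℝ
  Q_offDiag_nonneg : ∀ i j, i ≠ j → 0 ≤ Q i j
  Q_row_sum : ∀ i, ∑ j, Q i j = 0
  /-- Irreducibility: every state reaches every other one along positive rates. -/
  Q_irreducible : ∀ i j, Relation.ReflTransGen (fun a b => a ≠ b ∧ 0 < Q a b) i j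
  /-- The invariant distribution of the environment. -/
  envDist : Fin D → ℝ
  envDist_nonneg : ∀ d, 0 ≤ envDist d
  envDist_sum : ∑ d, envDist d = 1
  envDist_invariant : Matrix.vecMul envDist Q = 0
  /-- Total (unscaled) arrival rate in each state of the environment. -/
  lam : Fin D → ℝ
  lam_nonneg : ∀ d, 0 ≤ lam d
  /-- `alpha k d`: probability that a customer arriving in state `d` is of class `k`. -/
  alpha : Fin K → Fin D → ℝ
  alpha_nonneg : ∀ k d, 0 ≤ alpha k d
  alpha_sum : ∀ d, ∑ k, alpha k d = 1
  /-- Each class has a positive arrival rate in at least one state. -/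
  exists_arrival_pos : ∀ k, ∃ d, 0 < alpha k d * lam d
  /-- Service requirements of class `k` are exponential with mean `1 / mu k`. -/
  mu : Fin K → ℝ
  mu_pos : ∀ k, 0 < mu k
  /-- Service capacity in each state of the environment. -/
  cap : Fin D → ℝ
  cap_nonneg : ∀ d, 0 ≤ cap d
  exists_cap_pos : ∃ d, 0 < cap d
  /-- The DPS weights. -/
  g : Fin K → ℝ
  g_pos : ∀ k, 0 < g k

namespace ModulatedDPS

variable {K D : ℕ} (S : ModulatedDPS K D)

/-- States `(m, d)`: numbers of customers of each class, and the state of the environment. -/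
abbrev State (K D : ℕ) : Type := (Fin K → ℕ) × Fin D

/-- `μ_{k,d} = μ_k c_d`. -/
def muMod (k : Fin K) (d : Fin D) : ℝ := S.mu k * S.cap d

/-- `λ_{k,∞} = ∑_d λ_{k,d} π_d` with `λ_{k,d} = α_{k,d} λ_d`. -/
noncomputable def lamAvg (k : Fin K) : ℝ := ∑ d, S.alpha k d * S.lam d * S.envDist d

/-- `μ_{k,∞} = ∑_d μ_{k,d} π_d`. -/
noncomputable def muAvg (k : Fin K) : ℝ := ∑ d, S.muMod k d * S.envDist d

/-- The traffic intensity `ρ_∞ = ∑_k λ_{k,∞} / μ_{k,∞}` of the unscaled system. -/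
noncomputable def rho : ℝ := ∑ k, S.lamAvg k / S.muAvg k

/-- `λ_d^{(N)} = (λ_d / ρ_∞) (1 - 1/N)`. -/
noncomputable def lamScaled (N : ℝ) (d : Fin D) : ℝ := S.lam d / S.rho * (1 - 1 / N)

/-- `λ_{k,d}^{(N)} = α_{k,d} λ_d^{(N)}`. -/
noncomputable def classLamScaled (N : ℝ) (k : Fin K) (d : Fin D) : ℝ :=
  S.alpha k d * S.lamScaled N d

/-- Fraction `g_k m_k / ∑_j g_j m_j` of the capacity that is given to class `k`
(it is `0` in the empty system). -/
noncomputable def share (m : Fin K → ℕ) (k : Fin K) : ℝ :=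
  S.g k * m k / ∑ j, S.g j * m j

/-- Transition rate from `x` to `y`, for `x ≠ y` (it is `0` for `x = y`), of the continuous-time
Markov chain of queue lengths and environment in the `N`-th system: arrivals, service completions
and changes of the environment. -/
noncomputable def transitionRate (N : ℝ) (x y : State K D) : ℝ :=
  (∑ k, if y = (x.1 + Pi.single k 1, x.2) then S.classLamScaled N k x.2 else 0)
  + (∑ k, if 0 < x.1 k ∧ y = (x.1 - Pi.single k 1, x.2) then
      S.share x.1 k * S.muMod k x.2 else 0)
  + (if y.1 = x.1 ∧ y.2 ≠ x.2 then S.Q x.2 y.2 else 0)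

/-- `p` is a stationary distribution of the `N`-th system: a probability mass function for which
in every state the total flow out equals the total flow in. -/
structure IsStationary (N : ℝ) (p : State K D → ℝ) : Prop where
  nonneg : ∀ x, 0 ≤ p x
  hasSum_one : HasSum p 1
  balance : ∀ y, p y * ∑' x, S.transitionRate N y x = ∑' x, p x * S.transitionRate N x y

end ModulatedDPS

/-- Partial generating function `P_d(z) = E[z_1^{M_1} ⋯ z_K^{M_K} 1{Z = d}]` of the law `p` of
`(M, Z)`. -/
noncomputable def partialPGF {K D : ℕ} (p : ModulatedDPS.State K D → ℝ) (d : Fin D)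
    (z : Fin K → ℝ) : ℝ :=
  ∑' m : Fin K → ℕ, p (m, d) * ∏ k, z k ^ m k

/-!
For a bounded function `f` of the state, the generator applied to `f` has mean zero under the
stationary distribution. For `f(m, e) = z ^ m * 1{e = d}` the environment contributes
`∑ e, P_e(z) * Q e d` to this mean. Since the arrival and service rates are bounded and
`|z ^ (m ± e_k) - z ^ m| ≤ 1 - z_k`, arrivals and departures contribute at most a constant times
`∑ k, (1 - z_k)`, which vanishes at `z = e^{-s/N}` as `N → ∞`. The vector of the limits is therefore
a left null vector of `Q`, hence a multiple of the invariant distribution by irreducibility.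
Independence then follows because a finite measure on the nonnegative orthant is determined by its
Laplace transform on the open orthant.
-/

section JumpGenerator

variable {X : Type*} {r : X → X → ℝ} {p f : X → ℝ} {C : ℝ}

/-- The generator of a continuous-time Markov chain with jump rates `r x y`, acting on functions.
The diagonal of `r` plays no role. -/
noncomputable def jumpGenerator (r : X → X → ℝ) (f : X → ℝ) (x : X) : ℝ :=
  ∑' y, r x y * (f y - f x)

lemma summable_mul_of_abs_le (hp : Summable p) (hf : ∀ x, |f x| ≤ C) :
    Summable fun x => p x * f x := by
  refine Summable.of_norm_bounded (hp.abs.mul_right C) fun x => ?_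
  rw [Real.norm_eq_abs, abs_mul]
  exact mul_le_mul_of_nonneg_left (hf x) (abs_nonneg _)

lemma summable_mul_rate (hp0 : ∀ x, 0 ≤ p x) (hp : Summable p) (hr0 : ∀ x y, 0 ≤ r x y)
    (hr : ∀ x, Summable (r x)) (hC : ∀ x, ∑' y, r x y ≤ C) :
    Summable fun q : X × X => p q.1 * r q.1 q.2 := by
  refine (summable_prod_of_nonneg fun q => mul_nonneg (hp0 q.1) (hr0 q.1 q.2)).2
    ⟨fun x => (hr x).mul_left (p x), ?_⟩
  simp only [tsum_mul_left]
  refine summable_mul_of_abs_le (C := C) hp fun x => ?_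
  rw [abs_of_nonneg (tsum_nonneg (hr0 x))]
  exact hC x

theorem hasSum_mul_jumpGenerator_of_balance
    (hflow : Summable fun q : X × X => p q.1 * r q.1 q.2)
    (hbalance : ∀ y, p y * ∑' x, r y x = ∑' x, p x * r x y) (hf : ∀ x, |f x| ≤ C) :
    HasSum (fun x => p x * jumpGenerator r f x) 0 := by
  have hin : Summable fun q : X × X => p q.1 * r q.1 q.2 * f q.2 :=
    summable_mul_of_abs_le hflow fun q => hf q.2
  have hout : Summable fun q : X × X => p q.1 * r q.1 q.2 * f q.1 :=
    summable_mul_of_abs_le hflow fun q => hf q.1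
  have hfiber (x : X) : p x * jumpGenerator r f x =
      ∑' y, (p x * r x y * f y - p x * r x y * f x) := by
    simp only [jumpGenerator, ← tsum_mul_left, mul_sub, mul_assoc]
  have hin_eq_hout : ∑' q : X × X, p q.1 * r q.1 q.2 * f q.2 =
      ∑' q : X × X, p q.1 * r q.1 q.2 * f q.1 :=
    calc ∑' q : X × X, p q.1 * r q.1 q.2 * f q.2
        = ∑' y, ∑' x, p x * r x y * f y := by
          rw [hin.tsum_prod]
          exact (Summable.tsum_comm (f := fun x y => p x * r x y * f y) hin).symm
      _ = ∑' y, ∑' x, p y * r y x * f y := by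
          simp only [tsum_mul_right, tsum_mul_left, hbalance]
      _ = ∑' q : X × X, p q.1 * r q.1 q.2 * f q.1 := hout.tsum_prod.symm
  have hdiff := hin.sub hout
  have hzero := hin.hasSum.sub hout.hasSum
  rw [hin_eq_hout, sub_self] at hzero
  simp only [hfiber]
  exact hzero.prod_fiberwise fun x => (hdiff.prod_factor x).hasSum

end JumpGenerator

section NullVector

variable {n R : Type*} [Fintype n]

lemma eq_zero_of_vecMul_eq_zero_of_apply_eq_zero [Ring R] [LinearOrder R] [IsStrictOrderedRing R]
    {A : Matrix n n R} (hA : ∀ i j, i ≠ j → 0 ≤ A i j) {j : n}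
    (hreach : ∀ i, Relation.ReflTransGen (fun a b => 0 < A a b) i j)
    {w : n → R} (hw : ∀ i, 0 ≤ w i) (hwA : Matrix.vecMul w A = 0) (hj : w j = 0) :
    w = 0 := by
  have hpred (a b : n) (hab : 0 < A a b) (hb : w b = 0) : w a = 0 := by
    have hsum : ∑ i, w i * A i b = 0 := congrFun hwA b
    have hterm (i : n) : 0 ≤ w i * A i b := by
      obtain rfl | hib := eq_or_ne i b
      · rw [hb, zero_mul]
      · exact mul_nonneg (hw i) (hA i b hib)
    have hzero := (Finset.sum_eq_zero_iff_of_nonneg fun i _ => hterm i).1 hsum a (Finset.mem_univ a)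
    exact (mul_eq_zero.1 hzero).resolve_right hab.ne'
  funext i
  induction hreach i using Relation.ReflTransGen.head_induction_on with
  | refl => exact hj
  | head hab _ hb => exact hpred _ _ hab hb

theorem eq_sum_smul_of_vecMul_eq_zero [Field R] [LinearOrder R] [IsStrictOrderedRing R]
    {A : Matrix n n R} (hA : ∀ i j, i ≠ j → 0 ≤ A i j)
    (hirr : ∀ i j, Relation.ReflTransGen (fun a b => 0 < A a b) i j)
    {π : n → R} (hπ : ∀ i, 0 ≤ π i) (hπ_sum : ∑ i, π i = 1) (hπA : Matrix.vecMul π A = 0)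
    {v : n → R} (hvA : Matrix.vecMul v A = 0) : v = (∑ i, v i) • π := by
  have hπ_pos (i : n) : 0 < π i := by
    refine (hπ i).lt_of_ne' fun hi => ?_
    have hπ_zero := eq_zero_of_vecMul_eq_zero_of_apply_eq_zero hA (hirr · i) hπ hπA hi
    simp [hπ_zero] at hπ_sum
  have hn : (Finset.univ : Finset n).Nonempty :=
    Finset.nonempty_of_sum_ne_zero (hπ_sum.trans_ne one_ne_zero)
  -- Subtract the largest multiple of `π` that keeps the difference nonnegative.
  obtain ⟨j, -, hj⟩ := Finset.exists_min_image Finset.univ (fun i => v i / π i) hn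
  set c := v j / π j with hc
  have hdiff : v - c • π = 0 := by
    refine eq_zero_of_vecMul_eq_zero_of_apply_eq_zero hA (hirr · j) (fun i => ?_) ?_ ?_
    · exact sub_nonneg.2 ((le_div_iff₀ (hπ_pos i)).1 (hj i (Finset.mem_univ i)))
    · rw [Matrix.sub_vecMul, Matrix.smul_vecMul, hvA, hπA, smul_zero, sub_zero]
    · simp [hc, div_mul_cancel₀ _ (hπ_pos j).ne']
  have hv : v = c • π := sub_eq_zero.1 hdiff
  have hv_sum : ∑ i, v i = c := by
    simp only [hv, Pi.smul_apply, smul_eq_mul, ← Finset.mul_sum, hπ_sum, mul_one]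
  rw [hv_sum, ← hv]

end NullVector

section Monomial

variable {ι : Type*} [Fintype ι]

lemma prod_pow_add_single [DecidableEq ι] {M : Type*} [CommMonoid M] (z : ι → M) (m : ι → ℕ)
    (k : ι) : ∏ j, z j ^ (m + Pi.single k 1 : ι → ℕ) j = (∏ j, z j ^ m j) * z k := by
  simp only [Pi.add_apply, pow_add, Finset.prod_mul_distrib, Pi.single_apply, pow_ite, pow_one,
    pow_zero, Finset.prod_ite_eq', Finset.mem_univ, if_true]

variable {z : ι → ℝ} (hz : ∀ k, z k ∈ Set.Icc (0 : ℝ) 1)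
include hz

lemma prod_pow_mem_Icc (m : ι → ℕ) : ∏ j, z j ^ m j ∈ Set.Icc (0 : ℝ) 1 :=
  prod_mem (S := unitInterval.submonoid) fun j _ => pow_mem (hz j) (m j)

lemma abs_prod_pow_add_single_sub_le [DecidableEq ι] (m : ι → ℕ) (k : ι) :
    |∏ j, z j ^ (m + Pi.single k 1 : ι → ℕ) j - ∏ j, z j ^ m j| ≤ 1 - z k := by
  obtain ⟨hprod0, hprod1⟩ := prod_pow_mem_Icc hz m
  have hzk : 0 ≤ 1 - z k := sub_nonneg.2 (hz k).2
  rw [prod_pow_add_single, abs_sub_comm, ← mul_one_sub, abs_of_nonneg (mul_nonneg hprod0 hzk)]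
  exact mul_le_of_le_one_left hzk hprod1

lemma abs_prod_pow_sub_single_sub_le [DecidableEq ι] (m : ι → ℕ) (k : ι) :
    |∏ j, z j ^ (m - Pi.single k 1 : ι → ℕ) j - ∏ j, z j ^ m j| ≤ 1 - z k := by
  by_cases hmk : m k = 0
  · have hm : m - Pi.single k 1 = m := by
      funext j
      obtain rfl | hjk := eq_or_ne j k <;> simp [*]
    rw [hm, sub_self, abs_zero]
    exact sub_nonneg.2 (hz k).2
  · have hm : m - Pi.single k 1 + Pi.single k 1 = m :=
      tsub_add_cancel_of_le (update_le_iff.2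
        ⟨Nat.one_le_iff_ne_zero.2 hmk, fun j _ => Nat.zero_le (m j)⟩)
    have h := abs_prod_pow_add_single_sub_le hz (m - Pi.single k 1) k
    rwa [hm, abs_sub_comm] at h

end Monomial

namespace ModulatedDPS

variable {K D : ℕ} (S : ModulatedDPS K D) {N : ℝ}

lemma share_nonneg (m : Fin K → ℕ) (k : Fin K) : 0 ≤ S.share m k :=
  div_nonneg (mul_nonneg (S.g_pos k).le (Nat.cast_nonneg _))
    (Finset.sum_nonneg fun j _ => mul_nonneg (S.g_pos j).le (Nat.cast_nonneg _))

lemma share_le_one (m : Fin K → ℕ) (k : Fin K) : S.share m k ≤ 1 := by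
  have hterm (j : Fin K) : 0 ≤ S.g j * m j := mul_nonneg (S.g_pos j).le (Nat.cast_nonneg _)
  exact div_le_one_of_le₀
    (Finset.single_le_sum (f := fun j => S.g j * (m j : ℝ)) (fun j _ => hterm j)
      (Finset.mem_univ k))
    (Finset.sum_nonneg fun j _ => hterm j)

lemma share_eq_zero {m : Fin K → ℕ} {k : Fin K} (hmk : m k = 0) : S.share m k = 0 := by
  simp [share, hmk]

lemma muMod_nonneg (k : Fin K) (d : Fin D) : 0 ≤ S.muMod k d :=
  mul_nonneg (S.mu_pos k).le (S.cap_nonneg d)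

lemma share_mul_muMod_nonneg (m : Fin K → ℕ) (k : Fin K) (d : Fin D) :
    0 ≤ S.share m k * S.muMod k d :=
  mul_nonneg (S.share_nonneg m k) (S.muMod_nonneg k d)

lemma share_mul_muMod_le (m : Fin K → ℕ) (k : Fin K) (d : Fin D) :
    S.share m k * S.muMod k d ≤ S.muMod k d :=
  mul_le_of_le_one_left (S.muMod_nonneg k d) (S.share_le_one m k)

lemma rho_nonneg : 0 ≤ S.rho :=
  Finset.sum_nonneg fun k _ => div_nonneg
    (Finset.sum_nonneg fun d _ => mul_nonneg (mul_nonneg (S.alpha_nonneg k d) (S.lam_nonneg d))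
      (S.envDist_nonneg d))
    (Finset.sum_nonneg fun d _ => mul_nonneg (S.muMod_nonneg k d) (S.envDist_nonneg d))

lemma classLamScaled_nonneg (hN : 1 ≤ N) (k : Fin K) (d : Fin D) : 0 ≤ S.classLamScaled N k d := by
  have hfactor : 0 ≤ 1 - 1 / N := by
    rw [one_div]
    exact sub_nonneg.2 (inv_le_one_of_one_le₀ hN)
  exact mul_nonneg (S.alpha_nonneg k d)
    (mul_nonneg (div_nonneg (S.lam_nonneg d) S.rho_nonneg) hfactor)

lemma transitionRate_nonneg (hN : 1 ≤ N) (x y : State K D) : 0 ≤ S.transitionRate N x y := by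
  refine add_nonneg (add_nonneg (Finset.sum_nonneg fun k _ => ?_)
    (Finset.sum_nonneg fun k _ => ?_)) ?_
  · exact ite_nonneg (S.classLamScaled_nonneg hN k x.2) le_rfl
  · exact ite_nonneg (S.share_mul_muMod_nonneg x.1 k x.2) le_rfl
  · split_ifs with h
    exacts [S.Q_offDiag_nonneg x.2 y.2 h.2.symm, le_rfl]

lemma transitionRate_eq_sum_ite (m : Fin K → ℕ) (d : Fin D) (y : State K D) :
    S.transitionRate N (m, d) y =
      (∑ k, if y = (m + Pi.single k 1, d) then S.classLamScaled N k d else 0)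
      + (∑ k, if y = (m - Pi.single k 1, d) then S.share m k * S.muMod k d else 0)
      + ∑ e ∈ Finset.univ.erase d, if y = (m, e) then S.Q d e else 0 := by
  unfold transitionRate
  congr 1
  · congr 1
    refine Finset.sum_congr rfl fun k _ => ?_
    obtain hmk | hmk := Nat.eq_zero_or_pos (m k)
    · simp [hmk, S.share_eq_zero hmk]
    · simp [hmk]
  · obtain ⟨m', d'⟩ := y
    simp only [Prod.mk.injEq, ite_and, Finset.sum_ite_irrel, Finset.sum_ite_eq, Finset.mem_erase,
      Finset.mem_univ, and_true, Finset.sum_const_zero]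

lemma hasSum_transitionRate_mul (h : State K D → ℝ) (m : Fin K → ℕ) (d : Fin D) :
    HasSum (fun y => S.transitionRate N (m, d) y * h y)
      ((∑ k, S.classLamScaled N k d * h (m + Pi.single k 1, d))
      + (∑ k, S.share m k * S.muMod k d * h (m - Pi.single k 1, d))
      + ∑ e ∈ Finset.univ.erase d, S.Q d e * h (m, e)) := by
  have hjump (a : ℝ) (x : State K D) : HasSum (fun y => (if y = x then a else 0) * h y)
      (a * h x) := by
    simpa only [ite_mul, zero_mul, if_true] using
      hasSum_single (f := fun y => (if y = x then a else 0) * h y) x fun y hy => by simp [hy]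
  simp only [transitionRate_eq_sum_ite, add_mul, Finset.sum_mul]
  exact ((hasSum_sum fun k _ => hjump _ _).add (hasSum_sum fun k _ => hjump _ _)).add
    (hasSum_sum fun e _ => hjump _ _)

lemma summable_transitionRate (x : State K D) : Summable (S.transitionRate N x) := by
  simpa using (S.hasSum_transitionRate_mul (fun _ => 1) x.1 x.2).summable

lemma exists_tsum_transitionRate_le (N : ℝ) : ∃ C, ∀ x, ∑' y, S.transitionRate N x y ≤ C := by
  obtain ⟨C, hC⟩ := (Set.finite_range fun d => ∑ k, S.classLamScaled N k d + ∑ k, S.muMod k d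
    + ∑ e ∈ Finset.univ.erase d, S.Q d e).bddAbove
  refine ⟨C, fun ⟨m, d⟩ => le_trans ?_ (hC ⟨d, rfl⟩)⟩
  have hexit := (S.hasSum_transitionRate_mul (N := N) (fun _ => 1) m d).tsum_eq
  simp only [mul_one] at hexit
  rw [hexit]
  exact add_le_add_left (add_le_add_right
    (Finset.sum_le_sum fun k _ => S.share_mul_muMod_le m k d) _) _

/-- The generator of the queue-length process of the `N`-th system while the environment is frozen
in state `d`, acting on functions of the queue lengths. -/
noncomputable def queueGenerator (N : ℝ) (d : Fin D) (w : (Fin K → ℕ) → ℝ) (m : Fin K → ℕ) : ℝ :=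
  ∑ k, (S.classLamScaled N k d * (w (m + Pi.single k 1) - w m)
    + S.share m k * S.muMod k d * (w (m - Pi.single k 1) - w m))

lemma jumpGenerator_transitionRate_mul (w : (Fin K → ℕ) → ℝ) (φ : Fin D → ℝ) (m : Fin K → ℕ)
    (d : Fin D) :
    jumpGenerator (S.transitionRate N) (fun x => w x.1 * φ x.2) (m, d) =
      S.queueGenerator N d w m * φ d + w m * Matrix.mulVec S.Q φ d := by
  have henv : ∑ e ∈ Finset.univ.erase d, S.Q d e * (w m * φ e - w m * φ d) =
      w m * Matrix.mulVec S.Q φ d :=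
    calc ∑ e ∈ Finset.univ.erase d, S.Q d e * (w m * φ e - w m * φ d)
        = ∑ e, S.Q d e * (w m * φ e - w m * φ d) :=
          Finset.sum_erase _ (by rw [sub_self, mul_zero])
      _ = w m * ∑ e, S.Q d e * φ e - (∑ e, S.Q d e) * (w m * φ d) := by
          rw [Finset.mul_sum, Finset.sum_mul, ← Finset.sum_sub_distrib]
          exact Finset.sum_congr rfl fun e _ => by ring
      _ = w m * Matrix.mulVec S.Q φ d := by
          rw [S.Q_row_sum, zero_mul, sub_zero]
          rfl
  rw [jumpGenerator, (S.hasSum_transitionRate_mul _ m d).tsum_eq, henv, queueGenerator,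
    Finset.sum_add_distrib, add_mul, Finset.sum_mul, Finset.sum_mul]
  simp only [← sub_mul, mul_assoc]

lemma abs_queueGenerator_prod_pow_le (hN : 1 ≤ N) {z : Fin K → ℝ}
    (hz : ∀ k, z k ∈ Set.Icc (0 : ℝ) 1) (d : Fin D) (m : Fin K → ℕ) :
    |S.queueGenerator N d (fun m => ∏ k, z k ^ m k) m| ≤
      ∑ k, (S.classLamScaled N k d + S.muMod k d) * (1 - z k) := by
  refine (Finset.abs_sum_le_sum_abs _ _).trans (Finset.sum_le_sum fun k _ => ?_)
  rw [add_mul]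
  refine (abs_add_le _ _).trans (add_le_add ?_ ?_)
  · rw [abs_mul, abs_of_nonneg (S.classLamScaled_nonneg hN k d)]
    exact mul_le_mul_of_nonneg_left (abs_prod_pow_add_single_sub_le hz m k)
      (S.classLamScaled_nonneg hN k d)
  · rw [abs_mul, abs_of_nonneg (S.share_mul_muMod_nonneg m k d)]
    exact mul_le_mul (S.share_mul_muMod_le m k d) (abs_prod_pow_sub_single_sub_le hz m k)
      (abs_nonneg _) (S.muMod_nonneg k d)

end ModulatedDPS

section PartialPGF

variable {K D : ℕ} {z : Fin K → ℝ} (hz : ∀ k, z k ∈ Set.Icc (0 : ℝ) 1)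
include hz

lemma abs_prod_pow_mul_le (φ : Fin D → ℝ) (x : ModulatedDPS.State K D) :
    |(∏ k, z k ^ x.1 k) * φ x.2| ≤ ∑ d, |φ d| := by
  obtain ⟨hprod0, hprod1⟩ := prod_pow_mem_Icc hz x.1
  rw [abs_mul, abs_of_nonneg hprod0]
  exact (mul_le_of_le_one_left (abs_nonneg _) hprod1).trans
    (Finset.single_le_sum (f := fun d => |φ d|) (fun d _ => abs_nonneg _) (Finset.mem_univ x.2))

lemma hasSum_mul_prod_pow_mul {p : ModulatedDPS.State K D → ℝ} (hp : Summable p) (φ : Fin D → ℝ) :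
    HasSum (fun x => p x * ((∏ k, z k ^ x.1 k) * φ x.2)) (∑ d, partialPGF p d z * φ d) := by
  have hsummable : Summable fun x => p x * ((∏ k, z k ^ x.1 k) * φ x.2) :=
    summable_mul_of_abs_le hp (abs_prod_pow_mul_le hz φ)
  have hfiber (d : Fin D) : HasSum (fun m => p (m, d) * ((∏ k, z k ^ m k) * φ d))
      (partialPGF p d z * φ d) := by
    have h := (hsummable.prod_symm.prod_factor d).hasSum
    simpa only [Prod.swap_prod_mk, partialPGF, ← tsum_mul_right, mul_assoc] using h
  have hswap := hsummable.prod_symm.hasSum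
  rw [(hswap.prod_fiberwise hfiber).unique (hasSum_fintype _)] at hswap
  exact (Equiv.prodComm (Fin D) (Fin K → ℕ)).hasSum_iff.1 hswap

end PartialPGF

namespace ModulatedDPS

variable {K D : ℕ} {S : ModulatedDPS K D}

section Stationary

variable {N : ℝ} {p : State K D → ℝ}

lemma IsStationary.hasSum_mul_jumpGenerator (hp : S.IsStationary N p) (hN : 1 ≤ N)
    {f : State K D → ℝ} {C : ℝ} (hf : ∀ x, |f x| ≤ C) :
    HasSum (fun x => p x * jumpGenerator (S.transitionRate N) f x) 0 := by
  obtain ⟨R, hR⟩ := S.exists_tsum_transitionRate_le N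
  exact hasSum_mul_jumpGenerator_of_balance (summable_mul_rate hp.nonneg hp.hasSum_one.summable
    (S.transitionRate_nonneg hN) S.summable_transitionRate hR) hp.balance hf

variable {z : Fin K → ℝ} (hz : ∀ k, z k ∈ Set.Icc (0 : ℝ) 1)
include hz

lemma IsStationary.hasSum_mul_queueGenerator (hp : S.IsStationary N p) (hN : 1 ≤ N)
    (φ : Fin D → ℝ) :
    HasSum (fun x => p x * (S.queueGenerator N x.2 (fun m => ∏ k, z k ^ m k) x.1 * φ x.2))
      (-∑ d, partialPGF p d z * Matrix.mulVec S.Q φ d) := by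
  have htotal := hp.hasSum_mul_jumpGenerator hN (abs_prod_pow_mul_le hz φ)
  have henv := hasSum_mul_prod_pow_mul hz hp.hasSum_one.summable (Matrix.mulVec S.Q φ)
  rw [← zero_sub]
  refine (htotal.sub henv).congr_fun fun x => ?_
  rw [S.jumpGenerator_transitionRate_mul (fun m => ∏ k, z k ^ m k) φ x.1 x.2]
  ring

lemma IsStationary.abs_vecMul_partialPGF_le (hp : S.IsStationary N p) (hN : 1 ≤ N) (d : Fin D) :
    |Matrix.vecMul (fun e => partialPGF p e z) S.Q d| ≤
      ∑ k, (S.classLamScaled N k d + S.muMod k d) * (1 - z k) := by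
  set B := ∑ k, (S.classLamScaled N k d + S.muMod k d) * (1 - z k)
  have hsum := hp.hasSum_mul_queueGenerator hz hN (Pi.single d 1)
  simp only [Matrix.mulVec_single_one] at hsum
  have hbound (x : State K D) :
      ‖p x * (S.queueGenerator N x.2 (fun m => ∏ k, z k ^ m k) x.1 *
        (Pi.single d 1 : Fin D → ℝ) x.2)‖ ≤ p x * B := by
    rw [norm_mul, Real.norm_of_nonneg (hp.nonneg x)]
    refine mul_le_mul_of_nonneg_left ?_ (hp.nonneg x)
    obtain hxd | hxd := eq_or_ne x.2 d
    · simpa [hxd] using S.abs_queueGenerator_prod_pow_le hN hz d x.1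
    · simpa [hxd] using (abs_nonneg _).trans (S.abs_queueGenerator_prod_pow_le hN hz d x.1)
  have hle := tsum_of_norm_bounded (by simpa using hp.hasSum_one.mul_right B) hbound
  rw [hsum.tsum_eq, norm_neg] at hle
  exact hle

end Stationary

lemma tendsto_classLamScaled (S : ModulatedDPS K D) (k : Fin K) (d : Fin D) :
    Tendsto (fun N => S.classLamScaled N k d) atTop (𝓝 (S.alpha k d * (S.lam d / S.rho))) := by
  have hfactor : Tendsto (fun N : ℝ => 1 - 1 / N) atTop (𝓝 1) := by
    simpa using (tendsto_inv_atTop_zero (𝕜 := ℝ)).const_sub 1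
  simpa [classLamScaled, lamScaled] using (hfactor.const_mul _).const_mul _

lemma tendsto_sum_rate_mul_one_sub_exp (S : ModulatedDPS K D) (s : Fin K → ℝ) (d : Fin D) :
    Tendsto (fun N : ℝ => ∑ k, (S.classLamScaled N k d + S.muMod k d) *
      (1 - Real.exp (-s k / N))) atTop (𝓝 0) := by
  have hexp (k : Fin K) : Tendsto (fun N : ℝ => 1 - Real.exp (-s k / N)) atTop (𝓝 0) := by
    have h := (Real.continuous_exp.tendsto 0).comp (tendsto_const_nhds.div_atTop
      (a := -s k) (tendsto_id (α := ℝ)))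
    simpa using h.const_sub 1
  simpa using tendsto_finsetSum Finset.univ fun k _ =>
    ((S.tendsto_classLamScaled k d).add_const (S.muMod k d)).mul (hexp k)

variable {p : ℝ → State K D → ℝ} (hp : ∀ N : ℝ, 1 < N → S.IsStationary N (p N))
  {l : Filter ℝ} [l.NeBot] (hl : l ≤ atTop) {s : Fin K → ℝ} (hs : ∀ k, 0 ≤ s k)
  {Phat : Fin D → ℝ}
  (hPhat : ∀ d, Tendsto (fun N : ℝ => partialPGF (p N) d (fun k => Real.exp (-s k / N))) l
    (𝓝 (Phat d)))
include hp hl hs hPhat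

lemma vecMul_eq_zero_of_tendsto_partialPGF : Matrix.vecMul Phat S.Q = 0 := by
  funext d
  have hlim : Tendsto (fun N : ℝ => Matrix.vecMul
      (fun e => partialPGF (p N) e (fun k => Real.exp (-s k / N))) S.Q d) l
      (𝓝 (Matrix.vecMul Phat S.Q d)) :=
    tendsto_finsetSum Finset.univ fun e _ => (hPhat e).mul_const (S.Q e d)
  refine tendsto_nhds_unique hlim (squeeze_zero_norm' ?_
    ((S.tendsto_sum_rate_mul_one_sub_exp s d).mono_left hl))
  filter_upwards [hl (eventually_gt_atTop 1)] with N hN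
  refine (hp N hN).abs_vecMul_partialPGF_le (fun k => ⟨(Real.exp_pos _).le, ?_⟩) hN.le d
  exact Real.exp_le_one_iff.2
    (div_nonpos_of_nonpos_of_nonneg (neg_nonpos.2 (hs k)) (zero_le_one.trans hN.le))

theorem eq_envDist_mul_sum_of_tendsto_partialPGF (d : Fin D) :
    Phat d = S.envDist d * ∑ e, Phat e := by
  have hnull := vecMul_eq_zero_of_tendsto_partialPGF hp hl hs hPhat
  have hmul := eq_sum_smul_of_vecMul_eq_zero S.Q_offDiag_nonneg
    (fun i j => Relation.ReflTransGen.mono (fun _ _ h => h.2) _ _ (S.Q_irreducible i j))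
    S.envDist_nonneg S.envDist_sum S.envDist_invariant hnull
  exact (congrFun hmul d).trans (mul_comm _ _)

end ModulatedDPS

open scoped NNReal BoundedContinuousFunction

section Laplace

variable {ι : Type*} [Fintype ι]

lemma norm_exp_neg_sum_mul_le_one {s x : ι → ℝ} (hs : ∀ k, 0 ≤ s k) (hx : ∀ k, 0 ≤ x k) :
    ‖Real.exp (-∑ k, s k * x k)‖ ≤ 1 := by
  rw [Real.norm_of_nonneg (Real.exp_pos _).le, Real.exp_le_one_iff, neg_nonpos]
  exact Finset.sum_nonneg fun k _ => mul_nonneg (hs k) (hx k)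

/-- The function `x ↦ e^{-s·x}` on the nonnegative orthant, where it is bounded; its integral
against a measure is the Laplace transform of the measure at `s`. -/
noncomputable def laplaceKernel (s : ι → ℝ≥0) : (ι → ℝ≥0) →ᵇ ℝ :=
  BoundedContinuousFunction.ofNormedAddCommGroup
    (fun x => Real.exp (-∑ k, (s k : ℝ) * x k)) (by fun_prop) 1 fun x =>
      norm_exp_neg_sum_mul_le_one (fun k => (s k).coe_nonneg) fun k => (x k).coe_nonneg

lemma laplaceKernel_apply (s x : ι → ℝ≥0) :
    laplaceKernel s x = Real.exp (-∑ k, (s k : ℝ) * x k) := rfl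

lemma norm_laplaceKernel_apply_le (s x : ι → ℝ≥0) : ‖laplaceKernel s x‖ ≤ 1 :=
  norm_exp_neg_sum_mul_le_one (fun k => (s k).coe_nonneg) fun k => (x k).coe_nonneg

lemma laplaceKernel_zero : laplaceKernel (0 : ι → ℝ≥0) = 1 := by
  ext x
  simp [laplaceKernel_apply]

lemma laplaceKernel_add (s t : ι → ℝ≥0) :
    laplaceKernel (s + t) = laplaceKernel s * laplaceKernel t := by
  ext x
  simp only [laplaceKernel_apply, BoundedContinuousFunction.mul_apply, ← Real.exp_add, ← neg_add,
    ← Finset.sum_add_distrib, ← add_mul, Pi.add_apply, NNReal.coe_add]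

lemma laplaceKernel_single [DecidableEq ι] (k : ι) (x : ι → ℝ≥0) :
    laplaceKernel (Pi.single k 1) x = Real.exp (-x k) := by
  simp [laplaceKernel_apply, Pi.single_apply, apply_ite]

/-- The multiplicative monoid of the functions `x ↦ e^{-s·x}` on the nonnegative orthant. -/
def laplaceSubmonoid (ι : Type*) [Fintype ι] : Submonoid ((ι → ℝ≥0) →ᵇ ℝ) where
  carrier := Set.range laplaceKernel
  one_mem' := ⟨0, laplaceKernel_zero⟩
  mul_mem' := by
    rintro _ _ ⟨s, rfl⟩ ⟨t, rfl⟩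
    exact ⟨s + t, laplaceKernel_add s t⟩

/-- The algebra generated by the functions `x ↦ e^{-s·x}` on the nonnegative orthant, bundled as a
star subalgebra for use in the Stone–Weierstrass criterion for equality of measures. -/
noncomputable def laplaceAlgebra (ι : Type*) [Fintype ι] : StarSubalgebra ℝ ((ι → ℝ≥0) →ᵇ ℝ) where
  toSubalgebra := Algebra.adjoin ℝ (laplaceSubmonoid ι)
  star_mem' {a} ha := by
    have hstar : star a = a := by
      ext x
      simp
    rwa [hstar]

lemma laplaceAlgebra_separatesPoints :
    ((laplaceAlgebra ι).map
      (BoundedContinuousFunction.toContinuousMapStarₐ ℝ)).SeparatesPoints := by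
  classical
  intro x y hxy
  obtain ⟨k, hk⟩ := Function.ne_iff.1 hxy
  refine ⟨laplaceKernel (Pi.single k 1),
    ⟨laplaceKernel (Pi.single k 1), ⟨_, Algebra.subset_adjoin ⟨Pi.single k 1, rfl⟩, rfl⟩, rfl⟩, ?_⟩
  simpa only [laplaceKernel_single, ne_eq, Real.exp_eq_exp, neg_inj, NNReal.coe_inj] using hk

lemma integral_eq_of_mem_laplaceAlgebra {μ ν : Measure (ι → ℝ≥0)} [IsFiniteMeasure μ]
    [IsFiniteMeasure ν] (h : ∀ s, ∫ x, laplaceKernel s x ∂μ = ∫ x, laplaceKernel s x ∂ν)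
    {f : (ι → ℝ≥0) →ᵇ ℝ} (hf : f ∈ laplaceAlgebra ι) : ∫ x, f x ∂μ = ∫ x, f x ∂ν := by
  have hspan : f ∈ Submodule.span ℝ (Set.range (laplaceKernel (ι := ι))) := by
    have hf' : f ∈ Subalgebra.toSubmodule (Algebra.adjoin ℝ (laplaceSubmonoid ι : Set _)) := hf
    rwa [Algebra.adjoin_eq_span, Submonoid.closure_eq] at hf'
  clear hf
  induction hspan using Submodule.span_induction with
  | mem f hf =>
    obtain ⟨s, rfl⟩ := hf
    exact h s
  | zero => simp
  | add f g _ _ hf hg =>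
    simp only [BoundedContinuousFunction.add_apply]
    rw [integral_add (f.integrable μ) (g.integrable μ),
      integral_add (f.integrable ν) (g.integrable ν), hf, hg]
  | smul c f _ hf =>
    simp only [BoundedContinuousFunction.coe_smul]
    rw [integral_smul, integral_smul, hf]

lemma tendsto_integral_laplaceKernel (μ : Measure (ι → ℝ≥0)) [IsFiniteMeasure μ]
    {u : ℕ → ι → ℝ≥0} {s : ι → ℝ≥0} (hu : Tendsto u atTop (𝓝 s)) :
    Tendsto (fun n => ∫ x, laplaceKernel (u n) x ∂μ) atTop (𝓝 (∫ x, laplaceKernel s x ∂μ)) := by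
  refine tendsto_integral_of_dominated_convergence (fun _ => 1)
    (fun n => (laplaceKernel _).continuous.aestronglyMeasurable) (integrable_const _)
    (fun n => .of_forall (norm_laplaceKernel_apply_le _)) (.of_forall fun x => ?_)
  have hcont : Continuous fun t : ι → ℝ≥0 => laplaceKernel t x := by
    simp only [laplaceKernel_apply]
    fun_prop
  exact (hcont.tendsto s).comp hu

theorem measure_eq_of_integral_laplaceKernel_eq {μ ν : Measure (ι → ℝ≥0)} [IsFiniteMeasure μ]
    [IsFiniteMeasure ν]
    (h : ∀ s : ι → ℝ≥0, (∀ k, 0 < s k) →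
      ∫ x, laplaceKernel s x ∂μ = ∫ x, laplaceKernel s x ∂ν) : μ = ν := by
  have hall (s : ι → ℝ≥0) : ∫ x, laplaceKernel s x ∂μ = ∫ x, laplaceKernel s x ∂ν := by
    let u (n : ℕ) (k : ι) : ℝ≥0 := s k + 1 / ((n : ℝ≥0) + 1)
    have hu_pos (n : ℕ) (k : ι) : 0 < u n k := by positivity
    have hu : Tendsto u atTop (𝓝 s) := tendsto_pi_nhds.2 fun k => by
      simpa [u] using (tendsto_one_div_add_atTop_nhds_zero_nat (𝕜 := ℝ≥0)).const_add (s k)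
    refine tendsto_nhds_unique (tendsto_integral_laplaceKernel μ hu) ?_
    simpa only [h _ (hu_pos _)] using tendsto_integral_laplaceKernel ν hu
  exact ext_of_forall_mem_subalgebra_integral_eq_of_pseudoEMetric_complete_countable
    laplaceAlgebra_separatesPoints fun f hf => integral_eq_of_mem_laplaceAlgebra hall hf

omit [Fintype ι] in
lemma map_coe_map_toNNReal {μ : Measure (ι → ℝ)} (hμ : ∀ᵐ x ∂μ, ∀ k, 0 ≤ x k) :
    (μ.map fun x k => (x k).toNNReal).map (fun y k => (y k : ℝ)) = μ := by
  rw [Measure.map_map (by fun_prop) (by fun_prop)]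
  conv_rhs => rw [← Measure.map_id (μ := μ)]
  refine Measure.map_congr ?_
  filter_upwards [hμ] with x hx
  funext k
  exact Real.coe_toNNReal _ (hx k)

theorem measure_eq_of_integral_exp_neg_eq {μ ν : Measure (ι → ℝ)} [IsFiniteMeasure μ]
    [IsFiniteMeasure ν] (hμ : ∀ᵐ x ∂μ, ∀ k, 0 ≤ x k) (hν : ∀ᵐ x ∂ν, ∀ k, 0 ≤ x k)
    (h : ∀ s : ι → ℝ, (∀ k, 0 < s k) →
      ∫ x, Real.exp (-∑ k, s k * x k) ∂μ = ∫ x, Real.exp (-∑ k, s k * x k) ∂ν) : μ = ν := by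
  have hmeas : Measurable fun (x : ι → ℝ) k => (x k).toNNReal := by fun_prop
  have htransform {ξ : Measure (ι → ℝ)} (hξ : ∀ᵐ x ∂ξ, ∀ k, 0 ≤ x k) (s : ι → ℝ≥0) :
      ∫ y, laplaceKernel s y ∂(ξ.map fun x k => (x k).toNNReal) =
        ∫ x, Real.exp (-∑ k, (s k : ℝ) * x k) ∂ξ := by
    rw [integral_map hmeas.aemeasurable (laplaceKernel s).continuous.aestronglyMeasurable]
    refine integral_congr_ae ?_
    filter_upwards [hξ] with x hx
    simp only [laplaceKernel_apply, Real.coe_toNNReal _ (hx _)]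
  rw [← map_coe_map_toNNReal hμ, ← map_coe_map_toNNReal hν]
  congr 1
  refine measure_eq_of_integral_laplaceKernel_eq fun s hs => ?_
  rw [htransform hμ, htransform hν]
  exact h (fun k => s k) hs

end Laplace

section Independence

variable {Ω ι κ : Type*} [MeasurableSpace Ω] {P : Measure Ω} [MeasurableSpace κ]
  [MeasurableSingletonClass κ] {Z : Ω → κ}

theorem indepFun_of_map_restrict_eq_smul [Countable κ] {E : Type*} [MeasurableSpace E]
    [IsProbabilityMeasure P] {X : Ω → E} (hX : Measurable X) (hZ : Measurable Z) {c : κ → ℝ≥0}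
    (h : ∀ d, (P.restrict (Z ⁻¹' {d})).map X = c d • P.map X) :
    IndepFun X Z P ∧ ∀ d, P (Z ⁻¹' {d}) = c d := by
  have hinter (A : Set E) (hA : MeasurableSet A) (d : κ) :
      P (X ⁻¹' A ∩ Z ⁻¹' {d}) = c d * P (X ⁻¹' A) := by
    have hA' := congrArg (fun μ : Measure E => μ A) (h d)
    rwa [Measure.smul_apply, Measure.map_apply hX hA, Measure.map_apply hX hA,
      Measure.restrict_apply (hX hA), ENNReal.smul_def, smul_eq_mul] at hA'
  have hlaw (d : κ) : P (Z ⁻¹' {d}) = c d := by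
    simpa using hinter Set.univ MeasurableSet.univ d
  refine ⟨indepFun_iff_measure_inter_preimage_eq_mul.2 fun A B hA hB => ?_, hlaw⟩
  have hmap : (P.restrict (X ⁻¹' A)).map Z = P (X ⁻¹' A) • P.map Z := by
    refine Measure.ext_of_singleton fun d => ?_
    have hd := measurableSet_singleton d
    rw [Measure.smul_apply, Measure.map_apply hZ hd, Measure.map_apply hZ hd,
      Measure.restrict_apply (hZ hd), Set.inter_comm, hinter A hA, hlaw, smul_eq_mul, mul_comm]
  have hB' := congrArg (fun μ : Measure κ => μ B) hmap
  simpa [Measure.map_apply hZ hB, Measure.restrict_apply (hZ hB), Set.inter_comm] using hB'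

variable [Fintype ι] {M : Ω → ι → ℝ}

theorem indepFun_of_setIntegral_exp_neg_eq [Countable κ] [IsProbabilityMeasure P]
    (hM : Measurable M) (hZ : Measurable Z) (hM0 : ∀ᵐ ω ∂P, ∀ k, 0 ≤ M ω k)
    {c : κ → ℝ} (hc : ∀ d, 0 ≤ c d)
    (h : ∀ s : ι → ℝ, (∀ k, 0 < s k) → ∀ d,
      ∫ ω in Z ⁻¹' {d}, Real.exp (-∑ k, s k * M ω k) ∂P =
        c d * ∫ ω, Real.exp (-∑ k, s k * M ω k) ∂P) :
    IndepFun M Z P ∧ ∀ d, P.real (Z ⁻¹' {d}) = c d := by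
  have hmap0 {Q : Measure Ω} (hQ : ∀ᵐ ω ∂Q, ∀ k, 0 ≤ M ω k) : ∀ᵐ x ∂Q.map M, ∀ k, 0 ≤ x k :=
    (ae_map_iff hM.aemeasurable (measurableSet_le measurable_const measurable_id)).2 hQ
  have hlaw (d : κ) : (P.restrict (Z ⁻¹' {d})).map M = (c d).toNNReal • P.map M := by
    refine measure_eq_of_integral_exp_neg_eq (hmap0 (ae_restrict_of_ae hM0))
      (Measure.ae_smul_measure (hmap0 hM0) _) fun s hs => ?_
    have hexp : Continuous fun x : ι → ℝ => Real.exp (-∑ k, s k * x k) := by fun_prop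
    rw [integral_smul_nnreal_measure, integral_map hM.aemeasurable hexp.aestronglyMeasurable,
      integral_map hM.aemeasurable hexp.aestronglyMeasurable, NNReal.smul_def,
      Real.coe_toNNReal _ (hc d), smul_eq_mul]
    exact h s hs d
  obtain ⟨hindep, hZ_law⟩ := indepFun_of_map_restrict_eq_smul hM hZ hlaw
  exact ⟨hindep, fun d => by simp [Measure.real, hZ_law d, hc d]⟩

lemma integrable_exp_neg_sum_mul [IsFiniteMeasure P] (hM : AEMeasurable M P)
    (hM0 : ∀ᵐ ω ∂P, ∀ k, 0 ≤ M ω k) {s : ι → ℝ} (hs : ∀ k, 0 ≤ s k) :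
    Integrable (fun ω => Real.exp (-∑ k, s k * M ω k)) P := by
  refine Integrable.of_bound (by fun_prop) 1 ?_
  filter_upwards [hM0] with ω hω
  exact norm_exp_neg_sum_mul_le_one hs hω

lemma sum_setIntegral_preimage_singleton [Fintype κ] (hZ : Measurable Z) {f : Ω → ℝ}
    (hf : Integrable f P) : ∑ d, ∫ ω in Z ⁻¹' {d}, f ω ∂P = ∫ ω, f ω ∂P := by
  rw [← integral_iUnion_fintype (fun d => hZ (measurableSet_singleton d))
    (fun a b hab => (Set.disjoint_singleton.2 hab).preimage Z) fun _ => hf.integrableOn,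
    ← Set.preimage_iUnion, Set.iUnion_of_singleton, Set.preimage_univ, setIntegral_univ]

end Independence

theorem mainTheorem6 {K D : ℕ} (S : ModulatedDPS K D)
    (p : ℝ → ModulatedDPS.State K D → ℝ)
    (hp : ∀ N : ℝ, 1 < N → S.IsStationary N (p N))
    (l : Filter ℝ) [l.NeBot] (hl : l ≤ atTop) :
    (∀ (s : Fin K → ℝ), (∀ k, 0 ≤ s k) → ∀ Phat : Fin D → ℝ,
      (∀ d, Tendsto (fun N : ℝ => partialPGF (p N) d (fun k => Real.exp (-s k / N))) l
        (𝓝 (Phat d))) →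
      ∀ d, Phat d = S.envDist d * ∑ e, Phat e) ∧
    (∀ {Ω : Type*} [MeasurableSpace Ω] (P : Measure Ω) [IsProbabilityMeasure P]
      (Mhat : Ω → Fin K → ℝ) (Zhat : Ω → Fin D), Measurable Mhat → Measurable Zhat →
      (∀ᵐ ω ∂P, ∀ k, 0 ≤ Mhat ω k) →
      (∀ s : Fin K → ℝ, (∀ k, 0 < s k) → ∀ d,
        Tendsto (fun N : ℝ => partialPGF (p N) d (fun k => Real.exp (-s k / N))) l
          (𝓝 (∫ ω in Zhat ⁻¹' {d}, Real.exp (-∑ k, s k * Mhat ω k) ∂P))) →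
      IndepFun Mhat Zhat P ∧ ∀ d, P.real (Zhat ⁻¹' {d}) = S.envDist d) := by
  have product_form := fun (s : Fin K → ℝ) (hs : ∀ k, 0 ≤ s k) (Phat : Fin D → ℝ) hPhat =>
    ModulatedDPS.eq_envDist_mul_sum_of_tendsto_partialPGF (Phat := Phat) hp hl hs hPhat
  refine ⟨product_form, fun P _ Mhat Zhat hM hZ hM0 hlim => ?_⟩
  refine indepFun_of_setIntegral_exp_neg_eq hM hZ hM0 S.envDist_nonneg fun s hs d => ?_
  have hs0 (k : Fin K) : 0 ≤ s k := (hs k).le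
  rw [product_form s hs0 _ (hlim s hs) d, sum_setIntegral_preimage_singleton hZ
    (integrable_exp_neg_sum_mul hM.aemeasurable hM0 hs0)]
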